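/- Let $G$ be a locally compact group, with a fixed left Haar measure $\mu$, and let $\mathbb S_2$ be the unit sphere of the complex Hilbert space $L_2(G)=L_2(G,\mu)$, with the uniformity of the norm distance. Let $G$ act on $\mathbb S_2$ by the left regular representation, $(g\cdot f)(x)=f(g^{-1}x)$. The following are equivalent. 1. $G$ is amenable: there is a left-invariant mean on $L_\infty(G)$ (bounded measurable complex functions modulo equality locally almost everywhere), that is, a positive linear functional $m$ with $m(1)=1$ and $m({}_g\psi)=m(\psi)$ for all $g\in G$ and $\psi\in L_\infty(G)$, where ${}_g\psi(x)=\psi(gx)$. 2. There is a left $G$-invariant mean on the space $C^b_u(\mathbb S_2)$ of bounded uniformly continuous complex functions on $\mathbb S_2$, that is, a continuous positive linear functional $\varphi$ of norm $1$ with $\varphi(1)=1$ and $\varphi({}_gF)=\varphi(F)$ for all $g\in G$ and $F\in C^b_u(\mathbb S_2)$, where ${}_gF(f)=F(g\cdot f)$. 3. The pair $(\mathbb S_2,G)$ has the concentration property: every finite cover of $\mathbb S_2$ contains a set $A$ such that for every entourage $V$ of $\mathbb S_2$ and every finite collection $g_1,\dots,g_n\in G$ one has $\bigcap_{i=1}^n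 g_i\cdot V[A]\neq\emptyset$, where $V[A]=\{y:\ (x,y)\in V\text{ for some }x\in A\}$. -/

import Mathlib

open MeasureTheory Set
open scoped ENNReal Uniformity BoundedContinuousFunction ComplexOrder Topology

noncomputable section

/-! ### The concentration property -/

/-- The `V`-neighbourhood `V[A]` of a set `A`. -/
def entourageNhd {X : Type*} (V : Set (X × X)) (A : Set X) : Set X :=
  {y | ∃ x ∈ A, (x, y) ∈ V}

/-- `A` is essential for the family `F` of self-maps of the uniform space `X`: for every entourage
`V` and every finite subfamily, the sets `f (V[A])` have a common point. -/
def IsEssential {X ι : Type*} [UniformSpace X] (F : ι → X → X) (A : Set X) : Prop :=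
  ∀ V ∈ 𝓤 X, ∀ s : Finset ι, (⋂ i ∈ s, F i '' entourageNhd V A).Nonempty

/-- The pair `(X, F)` has the concentration property: every finite cover of `X` has an essential
member. -/
def HasConcentrationProperty {X ι : Type*} [UniformSpace X] (F : ι → X → X) : Prop :=
  ∀ γ : Set (Set X), γ.Finite → ⋃₀ γ = univ → ∃ A ∈ γ, IsEssential F A

/-! ### Invariant means on bounded uniformly continuous functions -/

/-- `C^b_u(X)`: the bounded uniformly continuous complex functions, with the supremum norm. -/
def UCB (X : Type*) [UniformSpace X] : Submodule ℂ (X →ᵇ ℂ) where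
  carrier := {f | UniformContinuous f}
  add_mem' hf hg := hf.add hg
  zero_mem' := uniformContinuous_const
  smul_mem' c _ hf := hf.const_smul c

/-- The constant function `1`, as an element of `C^b_u(X)`. -/
def UCB.one (X : Type*) [UniformSpace X] : UCB X :=
  ⟨BoundedContinuousFunction.const X (1 : ℂ), uniformContinuous_const⟩

/-- The function `x ↦ f (T x)`, as an element of `C^b_u(X)`. -/
def UCB.comp {X : Type*} [UniformSpace X] (f : UCB X) (T : X → X) (hT : UniformContinuous T) :
    UCB X :=
  ⟨f.1.compContinuous ⟨T, hT.continuous⟩, UniformContinuous.comp f.2 hT⟩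

/-- A mean on `C^b_u(X)`: a continuous positive linear functional of norm `1` that sends the
constant function `1` to `1`. -/
structure UCB.IsMean {X : Type*} [UniformSpace X] (φ : UCB X →L[ℂ] ℂ) : Prop where
  nonneg : ∀ f : UCB X, (∀ x, 0 ≤ f.1 x) → 0 ≤ φ f
  map_one : φ (UCB.one X) = 1
  norm_eq_one : ‖φ‖ = 1

/-- There is a mean on `C^b_u(X)` that is invariant under all maps of the family `F`. -/
def HasInvariantUCBMean {X ι : Type*} [UniformSpace X] (F : ι → X → X)
    (hF : ∀ i, UniformContinuous (F i)) : Prop :=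
  ∃ φ : UCB X →L[ℂ] ℂ, UCB.IsMean φ ∧ ∀ (i : ι) (f : UCB X), φ (UCB.comp f (F i) (hF i)) = φ f

/-! ### Amenability of a locally compact group -/

/-- `A` is locally null: it meets every compact set in a null set. -/
def LocallyNull {G : Type*} [TopologicalSpace G] [MeasurableSpace G] (μ : Measure G)
    (A : Set G) : Prop :=
  ∀ K : Set G, IsCompact K → μ (A ∩ K) = 0

/-- The bounded measurable complex functions on `G`. -/
def BoundedMeasurable (G : Type*) [MeasurableSpace G] : Submodule ℂ (G → ℂ) where
  carrier := {f | Measurable f ∧ ∃ C : ℝ, ∀ x, ‖f x‖ ≤ C}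
  add_mem' := by
    rintro f g ⟨hf, C, hC⟩ ⟨hg, D, hD⟩
    exact ⟨hf.add hg, C + D, fun x => (norm_add_le _ _).trans (add_le_add (hC x) (hD x))⟩
  zero_mem' := ⟨measurable_const, 0, fun x => by simp⟩
  smul_mem' := by
    rintro c f ⟨hf, C, hC⟩
    refine ⟨hf.const_smul c, ‖c‖ * C, fun x => ?_⟩
    simpa using mul_le_mul_of_nonneg_left (hC x) (norm_nonneg c)

/-- The bounded measurable functions that vanish outside a locally null set. -/
def LocallyNullFunctions {G : Type*} [TopologicalSpace G] [MeasurableSpace G] (μ : Measure G) :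
    Submodule ℂ (BoundedMeasurable G) where
  carrier := {f | LocallyNull μ {x | f.1 x ≠ 0}}
  add_mem' := by
    intro f g hf hg K hK
    refine measure_mono_null ?_ (measure_union_null (hf K hK) (hg K hK))
    rintro x ⟨hx, hxK⟩
    by_cases h : f.1 x = 0
    · refine Or.inr ⟨fun h' => hx ?_, hxK⟩
      change f.1 x + g.1 x = 0
      rw [h, h', add_zero]
    · exact Or.inl ⟨h, hxK⟩
  zero_mem' := by
    intro K _
    simp
  smul_mem' := by
    intro c f hf K hK
    refine measure_mono_null ?_ (hf K hK)
    rintro x ⟨hx, hxK⟩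
    refine ⟨fun h => hx ?_, hxK⟩
    change c • f.1 x = 0
    rw [h, smul_zero]

/-- `L_∞(G)`: bounded measurable functions modulo equality locally almost everywhere. -/
abbrev LInfty {G : Type*} [TopologicalSpace G] [MeasurableSpace G] (μ : Measure G) : Type _ :=
  BoundedMeasurable G ⧸ LocallyNullFunctions μ

/-- The class in `L_∞(G)` of a bounded measurable function. -/
def LInfty.mk {G : Type*} [TopologicalSpace G] [MeasurableSpace G] (μ : Measure G)
    (f : BoundedMeasurable G) : LInfty μ :=
  (LocallyNullFunctions μ).mkQ f

/-- The constant function `1`. -/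
def BoundedMeasurable.one (G : Type*) [MeasurableSpace G] : BoundedMeasurable G :=
  ⟨fun _ => 1, measurable_const, 1, fun _ => by simp⟩

/-- The translate `x ↦ f (g * x)` of `f`. -/
def BoundedMeasurable.translate {G : Type*} [Group G] [MeasurableSpace G] [MeasurableMul G]
    (g : G) (f : BoundedMeasurable G) : BoundedMeasurable G :=
  ⟨fun x => f.1 (g * x), f.2.1.comp (measurable_const_mul g),
    let ⟨C, hC⟩ := f.2.2; ⟨C, fun x => hC (g * x)⟩⟩

/-- A locally compact group `G` is amenable: there is a left-invariant mean on `L_∞(G)`, that is, a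
positive linear functional which sends the constant function `1` to `1` and is invariant under all
left translations. (Such a functional is automatically continuous, of norm `1`. The locally null
sets do not depend on the choice of the Haar measure.) -/
def IsAmenable (G : Type*) [Group G] [TopologicalSpace G] [IsTopologicalGroup G]
    [LocallyCompactSpace G] [MeasurableSpace G] [BorelSpace G] : Prop :=
  ∃ m : LInfty (Measure.haar : Measure G) →ₗ[ℂ] ℂ,
    (∀ f : BoundedMeasurable G, (∀ x, 0 ≤ f.1 x) → 0 ≤ m (LInfty.mk _ f)) ∧
    m (LInfty.mk _ (BoundedMeasurable.one G)) = 1 ∧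
    ∀ (g : G) (f : BoundedMeasurable G),
      m (LInfty.mk _ (BoundedMeasurable.translate g f)) = m (LInfty.mk _ f)

/-! ### The left regular representation on the unit sphere of `L_2(G)` -/

/-- The unit sphere of `L_2(G)`, with the uniformity of the norm distance. -/
abbrev L2Sphere {G : Type*} [MeasurableSpace G] (μ : Measure G) : Type _ :=
  Metric.sphere (0 : Lp ℂ 2 μ) 1

/-- The left regular representation of `G`, restricted to the unit sphere of `L_2(G)`: the group
element `g` sends (the class of) `f` to (the class of) `x ↦ f (g⁻¹ * x)`. -/
def leftRegular {G : Type*} [Group G] [MeasurableSpace G] [MeasurableMul G] (μ : Measure G)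
    [μ.IsMulLeftInvariant] (g : G) (f : L2Sphere μ) : L2Sphere μ :=
  ⟨DomMulAct.mk g⁻¹ • f.1, by
    have h := f.2
    rw [mem_sphere_zero_iff_norm] at h ⊢
    rw [DomMulAct.norm_smul_Lp, h]⟩

theorem uniformContinuous_leftRegular {G : Type*} [Group G] [MeasurableSpace G] [MeasurableMul G]
    (μ : Measure G) [μ.IsMulLeftInvariant] (g : G) : UniformContinuous (leftRegular μ g) := by
  refine Isometry.uniformContinuous (Isometry.of_dist_eq fun f f' => ?_)
  exact DomMulAct.dist_smul_Lp _ _ _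

end

/-! Means travel between `L_∞(G)` and the sphere in both directions. Composing a function on the
sphere with an orbit map `x ↦ x · f` gives a bounded continuous function on `G`, so a mean on
`L_∞(G)` yields one on the sphere. Conversely `ψ` defines the uniformly continuous function `f ↦ ∫ ψ
|f|²`, and this assignment is equivariant, so means on the sphere pull back to `L_∞(G)`
(`HasInvariantUCBMean.isAmenable`).

Concentration gives an ultrafilter of essential sets, and the limit along it is an invariant mean
(`HasConcentrationProperty.hasInvariantUCBMean`).

For the converse, Hahn–Banach separation turns amenability into Reiter's condition
(`IsAmenable.exists_almost_invariant_density`). Square roots of almost invariant densities are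
almost invariant unit vectors, and these force some member of each finite cover to be essential
(`hasConcentrationProperty_of_almost_fixed`). -/

/-! ### Positive functionals are real and contractive. -/

section PositiveFunctional

variable {α : Type*} [MeasurableSpace α] {m : BoundedMeasurable α →ₗ[ℂ] ℂ}

theorem BoundedMeasurable.re_nonneg_of_positive
    (hm : ∀ f : BoundedMeasurable α, (∀ x, 0 ≤ f.1 x) → 0 ≤ m f)
    (f : BoundedMeasurable α) (hf : ∀ x, 0 ≤ (f.1 x).re) : 0 ≤ (m f).re := by
  obtain ⟨C, hC⟩ := f.2.2
  let u : BoundedMeasurable α := ⟨fun x => ((f.1 x).re : ℂ),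
    Complex.measurable_ofReal.comp (Complex.measurable_re.comp f.2.1), C, fun x => by
      rw [Complex.norm_real]; exact (Complex.abs_re_le_norm _).trans (hC x)⟩
  let v : BoundedMeasurable α := ⟨fun x => ((f.1 x).im : ℂ),
    Complex.measurable_ofReal.comp (Complex.measurable_im.comp f.2.1), C, fun x => by
      rw [Complex.norm_real]; exact (Complex.abs_im_le_norm _).trans (hC x)⟩
  let k : BoundedMeasurable α := ⟨fun _ => ((|C| : ℝ) : ℂ), measurable_const, |C|, fun x => by
    simp⟩
  have hf' : f = u + Complex.I • v := by
    refine Subtype.ext (funext fun x => ?_)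
    change f.1 x = ((f.1 x).re : ℂ) + Complex.I * ((f.1 x).im : ℂ)
    rw [mul_comm, Complex.re_add_im]
  have hu : 0 ≤ m u := hm u fun x => Complex.zero_le_real.2 (hf x)
  have hk : 0 ≤ m k := hm k fun x => Complex.zero_le_real.2 (abs_nonneg C)
  -- Adding a large constant makes the imaginary part `v` nonnegative, which shows that `m v` is
  -- real.
  have hv : 0 ≤ m (v + k) := hm _ fun x => by
    change (0 : ℂ) ≤ ((f.1 x).im : ℂ) + ((|C| : ℝ) : ℂ)
    rw [← Complex.ofReal_add, Complex.zero_le_real]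
    have h1 := (Complex.abs_im_le_norm (f.1 x)).trans ((hC x).trans (le_abs_self C))
    linarith [neg_abs_le (f.1 x).im]
  rw [map_add] at hv
  rw [Complex.nonneg_iff] at hu hk hv
  have : (m v).im = 0 := by
    have := hv.2
    rw [Complex.add_im] at this
    linarith [hk.2]
  rw [hf', map_add, map_smul, Complex.add_re, smul_eq_mul, Complex.mul_re]
  simp [this, hu.1]

/-- Rotate `f` by a unimodular `c` so that `c * m f` is `‖m f‖`; then `C - c f` has nonnegative real
part. -/
theorem BoundedMeasurable.norm_le_of_positive
    (hm : ∀ f : BoundedMeasurable α, (∀ x, 0 ≤ f.1 x) → 0 ≤ m f)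
    (h1 : m (BoundedMeasurable.one α) = 1)
    (f : BoundedMeasurable α) {C : ℝ} (hf : ∀ x, ‖f.1 x‖ ≤ C) : ‖m f‖ ≤ C := by
  obtain ⟨c, hc, hcf⟩ : ∃ c : ℂ, ‖c‖ = 1 ∧ ‖m f‖ = c * m f :=
    RCLike.exists_norm_eq_mul_self (m f)
  have h := BoundedMeasurable.re_nonneg_of_positive hm
    ((C : ℂ) • BoundedMeasurable.one α - c • f) fun x => by
      change 0 ≤ ((C : ℂ) * 1 - c * f.1 x).re
      have h2 : ‖c * f.1 x‖ ≤ C := by rw [norm_mul, hc, one_mul]; exact hf x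
      have h3 := (Complex.re_le_norm (c * f.1 x)).trans h2
      rw [Complex.sub_re, mul_one, Complex.ofReal_re]
      linarith
  rw [map_sub, map_smul, map_smul, h1, smul_eq_mul, smul_eq_mul, ← hcf, mul_one, Complex.sub_re,
    Complex.ofReal_re, Complex.ofReal_re] at h
  linarith

end PositiveFunctional

/-! ### Concentration, ultrafilter means and almost fixed points. -/

section Essential

variable {X ι : Type*} [UniformSpace X] {F : ι → X → X}

/-- Under the concentration property the sets that are not essential generate a proper ideal, so
some ultrafilter consists of essential sets. -/
theorem HasConcentrationProperty.exists_ultrafilter (h : HasConcentrationProperty F) :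
    ∃ U : Ultrafilter X, ∀ A ∈ U, IsEssential F A := by
  have hne : (Filter.generate {B : Set X | ¬ IsEssential F Bᶜ}).NeBot := by
    refine Filter.generate_neBot_iff.2 fun t ht htf => ?_
    by_contra hemp
    rw [not_nonempty_iff_eq_empty] at hemp
    obtain ⟨A, ⟨B, hB, rfl⟩, hA⟩ := h (compl '' t) (htf.image _) (by
      rw [← compl_sInter, hemp, compl_empty])
    exact ht hB hA
  refine ⟨Ultrafilter.of (Filter.generate {B : Set X | ¬ IsEssential F Bᶜ}), fun A hA => ?_⟩
  by_contra hA'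
  have h1 : Aᶜ ∈ Ultrafilter.of (Filter.generate {B : Set X | ¬ IsEssential F Bᶜ}) :=
    Ultrafilter.of_le _ (Filter.mem_generate_of_mem (by simpa using hA'))
  exact Ultrafilter.compl_notMem_iff.2 hA h1

theorem UCB.exists_tendsto (U : Ultrafilter X) (f : UCB X) : ∃ c, Filter.Tendsto f.1 U (𝓝 c) := by
  have h : (U.map f.1 : Filter ℂ) ≤ Filter.principal (Metric.closedBall 0 ‖f.1‖) := by
    rw [Filter.le_principal_iff]
    refine Filter.mem_map.2 (Filter.univ_mem' fun x => ?_)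
    simpa using f.1.norm_coe_le_norm x
  obtain ⟨c, -, hc⟩ := (isCompact_closedBall (0 : ℂ) ‖f.1‖).ultrafilter_le_nhds (U.map f.1) h
  exact ⟨c, hc⟩

/-- The limit along an ultrafilter, as a functional on `C^b_u(X)`. -/
noncomputable def UCB.ultrafilterLim (U : Ultrafilter X) : UCB X →L[ℂ] ℂ :=
  LinearMap.mkContinuous
    { toFun := fun f => (UCB.exists_tendsto U f).choose
      map_add' := fun f g => tendsto_nhds_unique (UCB.exists_tendsto U (f + g)).choose_spec
        ((UCB.exists_tendsto U f).choose_spec.add (UCB.exists_tendsto U g).choose_spec)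
      map_smul' := fun c f => tendsto_nhds_unique (UCB.exists_tendsto U (c • f)).choose_spec
        ((UCB.exists_tendsto U f).choose_spec.const_smul c) } 1 fun f => by
    rw [one_mul]
    exact le_of_tendsto (UCB.exists_tendsto U f).choose_spec.norm
      (Filter.Eventually.of_forall fun x => f.1.norm_coe_le_norm x)

theorem UCB.tendsto_ultrafilterLim (U : Ultrafilter X) (f : UCB X) :
    Filter.Tendsto f.1 U (𝓝 (UCB.ultrafilterLim U f)) :=
  (UCB.exists_tendsto U f).choose_spec

theorem UCB.norm_one_le [Nonempty X] : ‖UCB.one X‖ ≤ 1 :=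
  (BoundedContinuousFunction.norm_le zero_le_one).2 fun x => by simp [UCB.one]

theorem UCB.IsMean.of_norm_le [Nonempty X] {φ : UCB X →L[ℂ] ℂ}
    (h0 : ∀ f : UCB X, (∀ x, 0 ≤ f.1 x) → 0 ≤ φ f) (h1 : φ (UCB.one X) = 1)
    (h : ∀ f, ‖φ f‖ ≤ ‖f‖) : UCB.IsMean φ where
  nonneg := h0
  map_one := h1
  norm_eq_one := by
    refine le_antisymm (φ.opNorm_le_bound zero_le_one fun f => (h f).trans_eq (one_mul _).symm) ?_
    have := φ.le_opNorm (UCB.one X)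
    rw [h1, norm_one] at this
    exact this.trans (mul_le_of_le_one_right (norm_nonneg _) UCB.norm_one_le)

theorem UCB.isMean_ultrafilterLim (U : Ultrafilter X) : UCB.IsMean (UCB.ultrafilterLim U) := by
  have : Nonempty X := (U : Filter X).nonempty_of_neBot
  refine .of_norm_le (fun f hf => ?_) ?_ fun f => ?_
  · exact ge_of_tendsto (UCB.tendsto_ultrafilterLim U f) (Filter.Eventually.of_forall hf)
  · exact tendsto_nhds_unique (UCB.tendsto_ultrafilterLim U _) tendsto_const_nhds
  · exact le_of_tendsto (UCB.tendsto_ultrafilterLim U f).norm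
      (Filter.Eventually.of_forall fun x => f.1.norm_coe_le_norm x)

/-- If some member of the family is the identity, the concentration property yields an invariant
mean (even a multiplicative one). -/
theorem HasConcentrationProperty.hasInvariantUCBMean (h : HasConcentrationProperty F)
    (hF : ∀ i, UniformContinuous (F i)) {e : ι} (he : F e = id) : HasInvariantUCBMean F hF := by
  classical
  obtain ⟨U, hU⟩ := h.exists_ultrafilter
  refine ⟨UCB.ultrafilterLim U, UCB.isMean_ultrafilterLim U, fun i f => ?_⟩
  refine dist_eq_zero.1 ?_
  by_contra hne
  set c := UCB.ultrafilterLim U f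
  set d := UCB.ultrafilterLim U (UCB.comp f (F i) (hF i))
  have hpos : 0 < dist d c / 4 := by have := lt_of_le_of_ne dist_nonneg (Ne.symm hne); linarith
  set δ := dist d c / 4 with hδ
  have hA := hU _ (Filter.inter_mem
    (Metric.tendsto_nhds.1 (UCB.tendsto_ultrafilterLim U f) δ hpos)
    (Metric.tendsto_nhds.1 (UCB.tendsto_ultrafilterLim U (UCB.comp f (F i) (hF i))) δ hpos))
  -- The index `e` puts `y` near a point of `A`, so `f y` is near `c`; the index `i` gives `y = F i
  -- z` with `z` near a point of `A`, so `f y` is near `d`. Four errors below `δ` contradict `dist d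
  -- c = 4 δ`.
  obtain ⟨y, hy⟩ := hA _ (Filter.inter_mem (f.2 (Metric.dist_mem_uniformity hpos))
    ((UCB.comp f (F i) (hF i)).2 (Metric.dist_mem_uniformity hpos))) {e, i}
  simp only [Finset.mem_insert, Finset.mem_singleton, iInter_iInter_eq_or_left,
    iInter_iInter_eq_left, mem_inter_iff, he, image_id] at hy
  obtain ⟨⟨x, hx, hxy⟩, z, ⟨w, hw, hwz⟩, rfl⟩ := hy
  have h1 : dist (f.1 x) c < δ := hx.1
  have h2 : dist (f.1 x) (f.1 (F i z)) < δ := hxy.1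
  have h3 : dist (f.1 (F i w)) d < δ := hw.2
  have h4 : dist (f.1 (F i w)) (f.1 (F i z)) < δ := hwz.2
  have h5 := dist_triangle4 d (f.1 (F i w)) (f.1 (F i z)) (f.1 x)
  have h6 := dist_triangle d (f.1 x) c
  rw [dist_comm] at h3
  rw [dist_comm] at h2
  linarith

/-- Almost fixed points for the inverse maps give the concentration property. -/
theorem hasConcentrationProperty_of_almost_fixed {X ι : Type*} [PseudoMetricSpace X]
    {F F' : ι → X → X} (hF : ∀ i x, F i (F' i x) = x)
    (h : ∀ (s : Finset ι), ∀ ε > 0, ∃ x, ∀ i ∈ s, dist x (F' i x) < ε) :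
    HasConcentrationProperty F := by
  classical
  intro γ hγ hcov
  by_contra! hcon
  have hex : ∀ A ∈ γ, ∃ ε > 0, ∃ s : Finset ι, ¬ (⋂ i ∈ s, F i ''
      entourageNhd {p : X × X | dist p.1 p.2 < ε} A).Nonempty := by
    intro A hA
    have := hcon A hA
    unfold IsEssential at this
    push Not at this
    obtain ⟨V, hV, s, hs⟩ := this
    obtain ⟨ε, hε, hεV⟩ := Metric.mem_uniformity_dist.1 hV
    refine ⟨ε, hε, s, fun hne => (hne.mono ?_).ne_empty hs⟩
    refine iInter₂_mono fun i _ => image_mono ?_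
    rintro y ⟨x, hx, hxy⟩
    exact ⟨x, hx, hεV hxy⟩
  choose! ε hε s hs using hex
  obtain ⟨δ, hδ, hδε⟩ : ∃ δ > 0, ∀ A ∈ γ, δ ≤ ε A := by
    rcases γ.eq_empty_or_nonempty with rfl | hne
    · exact ⟨1, one_pos, by simp⟩
    · obtain ⟨A, hA, hmin⟩ := hγ.exists_minimalFor ε γ hne
      exact ⟨ε A, hε A hA, fun B hB => (le_total (ε A) (ε B)).elim id (hmin hB)⟩
  -- One point serves all members of the cover. If it lies in `A`, then `F' i x` lies in the
  -- neighbourhood of `A`, so `x = F i (F' i x)` is common to all the images.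
  obtain ⟨x, hx⟩ := h (hγ.toFinset.biUnion s) δ hδ
  obtain ⟨A, hA, hxA⟩ : x ∈ ⋃₀ γ := hcov ▸ mem_univ x
  refine hs A hA ⟨x, mem_iInter₂.2 fun i hi => ⟨F' i x, ⟨x, hxA, ?_⟩, hF i x⟩⟩
  exact (hx i (Finset.mem_biUnion.2 ⟨A, hγ.mem_toFinset.2 hA, hi⟩)).trans_le (hδε A hA)

end Essential

/-! ### The left regular representation as an action. -/

section Translation

variable {G : Type*} [Group G] [MeasurableSpace G] [MeasurableMul G] (μ : Measure G)
  [μ.IsMulLeftInvariant]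

/-- The left regular representation on `L^p`, in terms of the domain action. -/
theorem mk_inv_smul_mk_inv_smul {E : Type*} [NormedAddCommGroup E] {p : ℝ≥0∞} (g x : G)
    (f : Lp E p μ) :
    DomMulAct.mk g⁻¹ • DomMulAct.mk x⁻¹ • f = DomMulAct.mk (g * x)⁻¹ • f := by
  rw [smul_smul, mul_inv_rev]
  rfl

theorem leftRegular_mul (g x : G) (f : L2Sphere μ) :
    leftRegular μ (g * x) f = leftRegular μ g (leftRegular μ x f) :=
  Subtype.ext (mk_inv_smul_mk_inv_smul μ g x f.1).symm

theorem leftRegular_one : leftRegular μ (1 : G) = id := by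
  refine funext fun f => Subtype.ext ?_
  change DomMulAct.mk (1 : G)⁻¹ • f.1 = f.1
  rw [inv_one]
  exact one_smul _ _

end Translation

/-! ### From a mean on the group to a mean on the sphere. -/

section MeanOnSphere

variable {G : Type*} [Group G] [TopologicalSpace G] [IsTopologicalGroup G]
  [LocallyCompactSpace G] [MeasurableSpace G] [BorelSpace G] (μ : Measure G) [μ.IsHaarMeasure]
  [μ.Regular]

/-- Strong continuity of translations is what makes functions pulled back along orbits measurable on
`G`. -/
theorem continuous_mk_inv_smul {E : Type*} [NormedAddCommGroup E] {p : ℝ≥0∞} [Fact (1 ≤ p)]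
    (hp : p ≠ ∞) (f : Lp E p μ) : Continuous fun x : G => DomMulAct.mk x⁻¹ • f := by
  have h : Continuous fun x : G => DomMulAct.mk x⁻¹ :=
    DomMulAct.continuous_mk.comp continuous_inv
  have : Fact (p ≠ ∞) := ⟨hp⟩
  exact h.smul continuous_const

theorem continuous_leftRegular (f : L2Sphere μ) : Continuous fun x : G => leftRegular μ x f :=
  Continuous.subtype_mk (continuous_mk_inv_smul μ ENNReal.ofNat_ne_top f.1) _

/-- The pullback of functions on the sphere along an orbit map. -/
noncomputable def UCB.orbitMap (f : L2Sphere μ) : UCB (L2Sphere μ) →ₗ[ℂ] BoundedMeasurable G where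
  toFun F := ⟨fun x => F.1 (leftRegular μ x f),
    (F.1.continuous.comp (continuous_leftRegular μ f)).measurable, ‖F.1‖,
    fun _ => F.1.norm_coe_le_norm _⟩
  map_add' _ _ := rfl
  map_smul' _ _ := rfl

/-- An amenable group has an invariant mean on the unit sphere, provided that the latter is
nonempty: average along an orbit. -/
theorem IsAmenable.hasInvariantUCBMean [Nonempty (L2Sphere μ)] (h : IsAmenable G) :
    HasInvariantUCBMean (leftRegular μ) (uniformContinuous_leftRegular μ) := by
  obtain ⟨m, hpos, hone, hinv⟩ := h
  let f : L2Sphere μ := Classical.arbitrary _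
  let m' : BoundedMeasurable G →ₗ[ℂ] ℂ := m ∘ₗ (LocallyNullFunctions Measure.haar).mkQ
  have hbd : ∀ F : UCB (L2Sphere μ), ‖m' (UCB.orbitMap μ f F)‖ ≤ ‖F‖ := fun F =>
    BoundedMeasurable.norm_le_of_positive hpos hone _ fun x => F.1.norm_coe_le_norm _
  refine ⟨(m' ∘ₗ UCB.orbitMap μ f).mkContinuous 1 fun F => (hbd F).trans_eq (one_mul _).symm,
    .of_norm_le (fun F hF => hpos _ fun x => hF _) hone hbd, fun g F => ?_⟩
  refine Eq.trans (congrArg m' (Subtype.ext (funext fun x => ?_))) (hinv g (UCB.orbitMap μ f F))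
  exact congrArg F.1 (leftRegular_mul μ g x f).symm

end MeanOnSphere

/-! ### The functions `f ↦ ∫ ψ |f|²` on the sphere. -/

section VectorStates

/-- Changing one argument of the form at a time costs `‖M‖ * ‖f - g‖` on unit vectors, whence the
Lipschitz constant `2 * ‖M‖`. -/
theorem uniformContinuous_inner_map_sphere {H : Type*} [NormedAddCommGroup H]
    [InnerProductSpace ℂ H] (M : H →L[ℂ] H) :
    UniformContinuous fun f : Metric.sphere (0 : H) 1 => inner ℂ f.1 (M f.1) := by
  refine (LipschitzWith.of_dist_le_mul (K := 2 * ‖M‖₊) fun f g => ?_).uniformContinuous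
  have hf : ‖f.1‖ = 1 := mem_sphere_zero_iff_norm.1 f.2
  have hg : ‖g.1‖ = 1 := mem_sphere_zero_iff_norm.1 g.2
  have h1 : inner ℂ f.1 (M f.1) - inner ℂ g.1 (M g.1)
      = inner ℂ f.1 (M (f.1 - g.1)) + inner ℂ (f.1 - g.1) (M g.1) := by
    rw [map_sub, inner_sub_right, inner_sub_left]; ring
  have h2 : ‖inner ℂ f.1 (M (f.1 - g.1))‖ ≤ ‖M‖ * ‖f.1 - g.1‖ := by
    refine (norm_inner_le_norm _ _).trans ?_
    rw [hf, one_mul]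
    exact M.le_opNorm _
  have h3 : ‖inner ℂ (f.1 - g.1) (M g.1)‖ ≤ ‖M‖ * ‖f.1 - g.1‖ := by
    refine (norm_inner_le_norm _ _).trans ?_
    rw [mul_comm]
    refine mul_le_mul_of_nonneg_right ((M.le_opNorm _).trans_eq ?_) (norm_nonneg _)
    rw [hg, mul_one]
  rw [dist_eq_norm, h1, Subtype.dist_eq, dist_eq_norm]
  refine (norm_add_le _ _).trans ((add_le_add h2 h3).trans_eq ?_)
  push_cast
  ring

variable {α : Type*} [MeasurableSpace α] (μ : Measure α)

theorem BoundedMeasurable.memLp_top (ψ : BoundedMeasurable α) : MemLp ψ.1 ∞ μ :=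
  let ⟨C, hC⟩ := ψ.2.2
  memLp_top_of_bound ψ.2.1.aestronglyMeasurable C (Filter.Eventually.of_forall hC)

/-- The operator of multiplication by a bounded measurable function on `L_2`. -/
noncomputable def BoundedMeasurable.mulOperator (ψ : BoundedMeasurable α) :
    Lp ℂ 2 μ →L[ℂ] Lp ℂ 2 μ :=
  (ContinuousLinearMap.mul ℂ ℂ).holderL μ ∞ 2 2 ((BoundedMeasurable.memLp_top μ ψ).toLp ψ.1)

theorem BoundedMeasurable.inner_mulOperator (ψ : BoundedMeasurable α) (f : Lp ℂ 2 μ) :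
    inner ℂ f (BoundedMeasurable.mulOperator μ ψ f) = ∫ x, ψ.1 x * ((‖f x‖ ^ 2 : ℝ) : ℂ) ∂μ := by
  rw [L2.inner_def]
  refine integral_congr_ae ?_
  have h1 : BoundedMeasurable.mulOperator μ ψ f =ᵐ[μ]
      fun x => ContinuousLinearMap.mul ℂ ℂ ((BoundedMeasurable.memLp_top μ ψ).toLp ψ.1 x) (f x) :=
    ContinuousLinearMap.coeFn_holder _ _ _
  filter_upwards [h1, (BoundedMeasurable.memLp_top μ ψ).coeFn_toLp] with x hx hx'
  rw [hx, hx', ContinuousLinearMap.mul_apply', RCLike.inner_apply, mul_assoc, RCLike.mul_conj]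
  push_cast
  rfl

theorem Lp.norm_sq_eq_integral {E : Type*} [NormedAddCommGroup E] [InnerProductSpace ℂ E]
    (f : Lp E 2 μ) : ‖f‖ ^ 2 = ∫ x, ‖f x‖ ^ 2 ∂μ := by
  have h : inner ℂ f f = ((‖f‖ ^ 2 : ℝ) : ℂ) := by
    rw [inner_self_eq_norm_sq_to_K]; push_cast; rfl
  rw [L2.inner_def] at h
  have h' : (fun x => inner ℂ (f x) (f x)) = fun x => ((‖f x‖ ^ 2 : ℝ) : ℂ) := by
    funext x; rw [inner_self_eq_norm_sq_to_K]; push_cast; rfl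
  rw [h', integral_complex_ofReal] at h
  exact (Complex.ofReal_injective h).symm

theorem BoundedMeasurable.integrable_mul_norm_sq (ψ : BoundedMeasurable α) (f : Lp ℂ 2 μ) :
    Integrable (fun x => ψ.1 x * ((‖f x‖ ^ 2 : ℝ) : ℂ)) μ := by
  obtain ⟨C, hC⟩ := ψ.2.2
  have h : Integrable (fun x => ((‖f x‖ ^ 2 : ℝ) : ℂ)) μ :=
    ((memLp_two_iff_integrable_sq_norm (Lp.aestronglyMeasurable f)).1 (Lp.memLp f)).ofReal
  exact h.bdd_mul ψ.2.1.aestronglyMeasurable (Filter.Eventually.of_forall hC)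

/-- The vector states `f ↦ ∫ ψ |f|²`, as a linear map into `C^b_u` of the unit sphere. -/
noncomputable def BoundedMeasurable.vectorState :
    BoundedMeasurable α →ₗ[ℂ] UCB (L2Sphere μ) where
  toFun ψ :=
    have h : UniformContinuous
        fun f : L2Sphere μ => ∫ x, ψ.1 x * ((‖f.1 x‖ ^ 2 : ℝ) : ℂ) ∂μ := by
      simpa only [← BoundedMeasurable.inner_mulOperator]
        using uniformContinuous_inner_map_sphere (BoundedMeasurable.mulOperator μ ψ)
    ⟨BoundedContinuousFunction.ofNormedAddCommGroup _ h.continuous ‖BoundedMeasurable.mulOperator μ ψ‖ fun f => by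
      rw [← BoundedMeasurable.inner_mulOperator]
      refine (norm_inner_le_norm _ _).trans ?_
      have hf : ‖f.1‖ = 1 := mem_sphere_zero_iff_norm.1 f.2
      have := (BoundedMeasurable.mulOperator μ ψ).le_opNorm f.1
      rw [hf, mul_one] at this
      rwa [hf, one_mul], h⟩
  map_add' ψ χ := by
    refine Subtype.ext (BoundedContinuousFunction.ext fun f => ?_)
    refine Eq.trans (integral_congr_ae (Filter.Eventually.of_forall fun x => ?_))
      (integral_add (BoundedMeasurable.integrable_mul_norm_sq μ ψ f.1) (BoundedMeasurable.integrable_mul_norm_sq μ χ f.1))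
    exact add_mul _ _ _
  map_smul' c ψ := by
    refine Subtype.ext (BoundedContinuousFunction.ext fun f => ?_)
    refine Eq.trans (integral_congr_ae (Filter.Eventually.of_forall fun x => ?_))
      (integral_const_mul c _)
    exact mul_assoc _ _ _

theorem BoundedMeasurable.vectorState_apply (ψ : BoundedMeasurable α) (f : L2Sphere μ) :
    (BoundedMeasurable.vectorState μ ψ).1 f = ∫ x, ψ.1 x * ((‖f.1 x‖ ^ 2 : ℝ) : ℂ) ∂μ :=
  rfl

theorem BoundedMeasurable.vectorState_one :
    BoundedMeasurable.vectorState μ (BoundedMeasurable.one α) = UCB.one _ := by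
  refine Subtype.ext (BoundedContinuousFunction.ext fun f => ?_)
  rw [BoundedMeasurable.vectorState_apply]
  have h : ‖f.1‖ = 1 := mem_sphere_zero_iff_norm.1 f.2
  have h' := Lp.norm_sq_eq_integral μ f.1
  simp only [BoundedMeasurable.one, one_mul]
  rw [integral_complex_ofReal, ← h', h]
  simp [UCB.one]

theorem BoundedMeasurable.vectorState_nonneg {ψ : BoundedMeasurable α} (hψ : ∀ x, 0 ≤ ψ.1 x)
    (f : L2Sphere μ) : 0 ≤ (BoundedMeasurable.vectorState μ ψ).1 f := by
  rw [BoundedMeasurable.vectorState_apply]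
  have h : ∀ x, ψ.1 x * ((‖f.1 x‖ ^ 2 : ℝ) : ℂ) = (((ψ.1 x).re * ‖f.1 x‖ ^ 2 : ℝ) : ℂ) := by
    intro x
    have h1 := Complex.nonneg_iff.1 (hψ x)
    have h2 : ψ.1 x = ((ψ.1 x).re : ℂ) := Complex.ext rfl h1.2.symm
    rw [h2]; push_cast; rfl
  simp only [h]
  rw [integral_complex_ofReal, Complex.zero_le_real]
  exact integral_nonneg fun x => mul_nonneg (Complex.nonneg_iff.1 (hψ x)).1 (sq_nonneg _)

/-- Equivariance is the substitution `x ↦ g * x` under the left-invariant measure. -/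
theorem BoundedMeasurable.vectorState_translate {G : Type*} [Group G] [MeasurableSpace G]
    [MeasurableMul G] (μ : Measure G) [μ.IsMulLeftInvariant] (g : G) (ψ : BoundedMeasurable G) :
    BoundedMeasurable.vectorState μ (BoundedMeasurable.translate g ψ) =
      UCB.comp (BoundedMeasurable.vectorState μ ψ) (leftRegular μ g)
        (uniformContinuous_leftRegular μ g) := by
  refine Subtype.ext (BoundedContinuousFunction.ext fun f => ?_)
  change ∫ x, ψ.1 (g * x) * ((‖f.1 x‖ ^ 2 : ℝ) : ℂ) ∂μ =
    ∫ x, ψ.1 x * ((‖(leftRegular μ g f).1 x‖ ^ 2 : ℝ) : ℂ) ∂μ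
  have h : (leftRegular μ g f).1 =ᵐ[μ] fun x => f.1 (g⁻¹ * x) :=
    DomMulAct.smul_Lp_ae_eq (DomMulAct.mk g⁻¹) f.1
  have h1 : ∫ x, ψ.1 x * ((‖(leftRegular μ g f).1 x‖ ^ 2 : ℝ) : ℂ) ∂μ =
      ∫ x, ψ.1 x * ((‖f.1 (g⁻¹ * x)‖ ^ 2 : ℝ) : ℂ) ∂μ :=
    integral_congr_ae (h.mono fun x hx => by simp only [hx])
  rw [h1, ← integral_mul_left_eq_self (μ := μ)
    (fun x => ψ.1 x * ((‖f.1 (g⁻¹ * x)‖ ^ 2 : ℝ) : ℂ)) g]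
  simp

end VectorStates

/-! ### Locally null functions, and the mean on the group obtained from the sphere. -/

section LocallyNull

variable {G : Type*} [TopologicalSpace G] [MeasurableSpace G]

/-- A locally null measurable set is null for every regular measure on the support of any
function in `L^p`. -/
theorem LocallyNull.ae_eq_zero [OpensMeasurableSpace G] {μ : Measure G}
    [μ.InnerRegularCompactLTTop] {A : Set G} (hA : LocallyNull μ A) (hAm : MeasurableSet A)
    {E : Type*} [NormedAddCommGroup E] {p : ℝ≥0∞} (hp0 : p ≠ 0) (hp : p ≠ ∞) (f : Lp E p μ) :
    ∀ᵐ x ∂μ, x ∈ A → f x = 0 := by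
  -- Local nullity controls only compact sets. The superlevel sets of `f` have finite measure, so
  -- inner regularity applies to their intersections with `A`, and these exhaust `A ∩ {f ≠ 0}`.
  have hn : ∀ n : ℕ, μ (A ∩ {x | 1 / ((n : NNReal) + 1) ≤ ‖f x‖₊}) = 0 := by
    intro n
    have hfin : μ {x | 1 / ((n : NNReal) + 1) ≤ ‖f x‖₊} < ∞ :=
      MemLp.meas_ge_lt_top (f := f) (Lp.memLp f) hp0 hp (by positivity)
    have hm : MeasurableSet (A ∩ {x | 1 / ((n : NNReal) + 1) ≤ ‖f x‖₊}) :=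
      hAm.inter (measurableSet_le measurable_const (Lp.stronglyMeasurable f).nnnorm.measurable)
    rw [hm.measure_eq_iSup_isCompact_of_ne_top
      ((measure_mono inter_subset_right).trans_lt hfin).ne]
    simp only [ENNReal.iSup_eq_zero]
    intro K hKA hK
    rw [← inter_eq_self_of_subset_right (hKA.trans inter_subset_left)]
    exact hA K hK
  refine measure_mono_null ?_ (measure_iUnion_null hn)
  intro x hx
  simp only [mem_compl_iff, mem_ofPred_eq, not_forall] at hx
  obtain ⟨hxA, hx0⟩ := hx
  obtain ⟨n, hn⟩ := exists_nat_one_div_lt (norm_pos_iff.2 hx0)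
  exact mem_iUnion.2 ⟨n, hxA, NNReal.coe_le_coe.1 (by simpa using hn.le)⟩

/-- Two Haar measures are proportional on sets with compact closure, which is all that local nullity
tests. This reconciles `μ` with the measure `Measure.haar` in `IsAmenable`. -/
theorem LocallyNull.of_isHaarMeasure [Group G] [IsTopologicalGroup G] [LocallyCompactSpace G]
    [BorelSpace G] {μ ν : Measure G} [μ.IsHaarMeasure] [ν.IsHaarMeasure] {A : Set G}
    (hA : LocallyNull ν A) : LocallyNull μ A := by
  intro K hK
  rw [Measure.measure_isMulInvariant_eq_smul_of_isCompact_closure μ ν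
    (hK.closure_of_subset inter_subset_right), hA K hK, smul_zero]

theorem BoundedMeasurable.vectorState_eq_zero [Group G] [IsTopologicalGroup G]
    [LocallyCompactSpace G] [BorelSpace G] (μ ν : Measure G) [μ.IsHaarMeasure] [μ.Regular]
    [ν.IsHaarMeasure] {ψ : BoundedMeasurable G} (hψ : ψ ∈ LocallyNullFunctions ν) :
    BoundedMeasurable.vectorState μ ψ = 0 := by
  refine Subtype.ext (BoundedContinuousFunction.ext fun f => ?_)
  refine Eq.trans (integral_congr_ae ?_) (integral_zero G ℂ)
  have hA : LocallyNull μ {x | ψ.1 x ≠ 0} := LocallyNull.of_isHaarMeasure hψ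
  filter_upwards [hA.ae_eq_zero (ψ.2.1 (measurableSet_singleton 0).compl) two_ne_zero
    ENNReal.ofNat_ne_top f.1] with x hx
  by_cases h : ψ.1 x = 0
  · rw [h, zero_mul]
  · rw [hx h]; simp

/-- An invariant mean on the unit sphere restricts to one on `L_∞`, along the vector states. -/
theorem HasInvariantUCBMean.isAmenable [Group G] [IsTopologicalGroup G]
    [LocallyCompactSpace G] [BorelSpace G] {μ : Measure G} [μ.IsHaarMeasure] [μ.Regular]
    (h : HasInvariantUCBMean (leftRegular μ) (uniformContinuous_leftRegular μ)) :
    IsAmenable G := by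
  obtain ⟨φ, hφ, hinv⟩ := h
  refine ⟨(LocallyNullFunctions Measure.haar).liftQ
    (φ.toLinearMap ∘ₗ BoundedMeasurable.vectorState μ) fun ψ hψ => ?_, fun ψ hψ => ?_, ?_,
    fun g ψ => ?_⟩
  · rw [LinearMap.mem_ker, LinearMap.comp_apply,
      BoundedMeasurable.vectorState_eq_zero μ Measure.haar hψ, map_zero]
  · exact hφ.nonneg _ (BoundedMeasurable.vectorState_nonneg μ hψ)
  · exact (congrArg φ (BoundedMeasurable.vectorState_one μ)).trans hφ.map_one
  · exact (congrArg φ (BoundedMeasurable.vectorState_translate μ g ψ)).trans (hinv g _)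

end LocallyNull

/-! ### Reiter's condition by Hahn–Banach separation. -/

section Reiter

/-- The probability densities in `L^1`. -/
def probabilityDensities {α : Type*} [MeasurableSpace α] (μ : Measure α) : Set (Lp ℝ 1 μ) :=
  {f | 0 ≤ᵐ[μ] f ∧ ∫ x, f x ∂μ = 1}

theorem convex_probabilityDensities {α : Type*} [MeasurableSpace α] (μ : Measure α) :
    Convex ℝ (probabilityDensities μ) := by
  intro f hf g hg a b ha hb hab
  have h : ⇑(a • f + b • g) =ᵐ[μ] fun x => a * f x + b * g x := by
    filter_upwards [Lp.coeFn_add (a • f) (b • g), Lp.coeFn_smul a f, Lp.coeFn_smul b g]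
      with x h1 h2 h3
    simp only [h1, Pi.add_apply, h2, h3, Pi.smul_apply, smul_eq_mul]
  refine ⟨?_, ?_⟩
  · filter_upwards [h, hf.1, hg.1] with x hx hfx hgx
    rw [hx]
    exact add_nonneg (mul_nonneg ha hfx) (mul_nonneg hb hgx)
  · rw [integral_congr_ae h, integral_add ((L1.integrable_coeFn f).const_mul a)
      ((L1.integrable_coeFn g).const_mul b), integral_const_mul, integral_const_mul, hf.2, hg.2,
      mul_one, mul_one, hab]

theorem exists_mem_probabilityDensities {G : Type*} [Group G] [TopologicalSpace G]
    [MeasurableSpace G] [BorelSpace G] (μ : Measure G) [IsLocallyFiniteMeasure μ]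
    [μ.IsOpenPosMeasure] : (probabilityDensities μ).Nonempty := by
  obtain ⟨U, hU1, hU, hUfin⟩ := μ.exists_isOpen_measure_lt_top (1 : G)
  have hpos : 0 < μ.real U := ENNReal.toReal_pos (hU.measure_pos μ ⟨1, hU1⟩).ne' hUfin.ne
  refine ⟨indicatorConstLp 1 hU.measurableSet hUfin.ne (μ.real U)⁻¹, ?_, ?_⟩
  · filter_upwards [indicatorConstLp_coeFn (p := 1) (hs := hU.measurableSet) (hμs := hUfin.ne)
      (c := (μ.real U)⁻¹)] with x hx
    rw [hx]
    exact indicator_nonneg (fun _ _ => inv_nonneg.2 hpos.le) x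
  · rw [integral_indicatorConstLp, smul_eq_mul, mul_inv_cancel₀ hpos.ne']

theorem mk_inv_smul_mem_probabilityDensities {G : Type*} [Group G] [MeasurableSpace G]
    [MeasurableMul G] {μ : Measure G} [μ.IsMulLeftInvariant] {f : Lp ℝ 1 μ}
    (hf : f ∈ probabilityDensities μ) (g : G) :
    DomMulAct.mk g⁻¹ • f ∈ probabilityDensities μ := by
  have h : ⇑(DomMulAct.mk g⁻¹ • f) =ᵐ[μ] fun x => f (g⁻¹ * x) :=
    DomMulAct.smul_Lp_ae_eq (DomMulAct.mk g⁻¹) f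
  refine ⟨?_, ?_⟩
  · filter_upwards [h, (measurePreserving_mul_left μ g⁻¹).quasiMeasurePreserving.ae hf.1]
      with x hx hfx
    rw [hx]
    exact hfx
  · rw [integral_congr_ae h, integral_mul_left_eq_self (μ := μ) f, hf.2]

variable {G : Type*} [Group G] [TopologicalSpace G] [IsTopologicalGroup G]
  [LocallyCompactSpace G] [MeasurableSpace G] [BorelSpace G] (μ : Measure G) [μ.IsHaarMeasure]
  [μ.Regular]

/-- The coefficient `x ↦ Λ (x • f)` of the left translation action on `L^1`. -/
noncomputable def translationCoefficient (Λ : Lp ℝ 1 μ →L[ℝ] ℝ) (f : Lp ℝ 1 μ) :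
    BoundedMeasurable G :=
  ⟨fun x => (Λ (DomMulAct.mk x⁻¹ • f) : ℂ),
    Complex.measurable_ofReal.comp
      (Λ.continuous.comp (continuous_mk_inv_smul μ ENNReal.one_ne_top f)).measurable,
    ‖Λ‖ * ‖f‖, fun x => by
      rw [Complex.norm_real]
      exact (Λ.le_opNorm _).trans_eq (by rw [DomMulAct.norm_smul_Lp])⟩

/-- Reiter's condition: an amenable group has almost invariant probability densities. -/
theorem IsAmenable.exists_almost_invariant_density (h : IsAmenable G) (s : Finset G) {ε : ℝ}
    (hε : 0 < ε) : ∃ f ∈ probabilityDensities μ, ∀ g ∈ s, ‖DomMulAct.mk g⁻¹ • f - f‖ < ε := by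
  classical
  obtain ⟨m, hpos, hone, hinv⟩ := h
  let m' : BoundedMeasurable G →ₗ[ℂ] ℂ := m ∘ₗ (LocallyNullFunctions Measure.haar).mkQ
  let T : Lp ℝ 1 μ →ₗ[ℝ] (s → Lp ℝ 1 μ) :=
    { toFun := fun f g => DomMulAct.mk (g : G)⁻¹ • f - f
      map_add' := fun f f' => by
        funext g
        simp only [Pi.add_apply, smul_add]
        abel
      map_smul' := fun c f => by
        funext g
        simp only [Pi.smul_apply, RingHom.id_apply, smul_sub]
        rw [smul_comm] }
  by_contra! hcon
  have hdisj : Disjoint (Metric.ball (0 : s → Lp ℝ 1 μ) ε) (T '' probabilityDensities μ) := by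
    rw [Set.disjoint_right]
    rintro _ ⟨f, hf, rfl⟩ hball
    obtain ⟨g, hg, hgε⟩ := hcon f hf
    rw [mem_ball_zero_iff] at hball
    exact absurd ((norm_le_pi_norm (T f) ⟨g, hg⟩).trans_lt hball) (not_lt.2 hgε)
  -- If no density is almost invariant, the convex set of displacements `T f` misses a norm ball
  -- about `0`, so some `Λ` is at least `u > 0` on it.
  obtain ⟨Λ, u, hu1, hu2⟩ := geometric_hahn_banach_open (convex_ball _ _) Metric.isOpen_ball
    ((convex_probabilityDensities μ).linear_image T) hdisj
  have hu : 0 < u := by simpa using hu1 0 (Metric.mem_ball_self hε)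
  obtain ⟨f, hf⟩ := exists_mem_probabilityDensities μ
  let Λ' : s → Lp ℝ 1 μ →L[ℝ] ℝ := fun g => Λ ∘L ContinuousLinearMap.single ℝ (fun _ : s => Lp ℝ 1 μ) g
  have hΛ : ∀ v, Λ v = ∑ g, Λ' g (v g) := fun v => by
    conv_lhs => rw [← Finset.univ_sum_single v]
    rw [map_sum]
    rfl
  -- Evaluating `Λ ∘ T` along the orbit of one density gives a sum of differences between translates
  -- and originals. Its mean is `0`, yet it is everywhere at least `u`.
  let ψ : BoundedMeasurable G := ∑ g : s, (BoundedMeasurable.translate (g : G)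
    (translationCoefficient μ (Λ' g) f) - translationCoefficient μ (Λ' g) f)
  have hψ : ∀ x, ψ.1 x = (Λ (T (DomMulAct.mk x⁻¹ • f)) : ℂ) := fun x => by
    have h1 : ψ.1 x = ∑ g : s, ((Λ' g (DomMulAct.mk ((g : G) * x)⁻¹ • f) : ℂ)
        - (Λ' g (DomMulAct.mk x⁻¹ • f) : ℂ)) := by
      simp only [ψ, Submodule.coe_sum, Finset.sum_apply]
      rfl
    rw [h1, hΛ, Complex.ofReal_sum]
    refine Finset.sum_congr rfl fun g _ => ?_
    change _ = ((Λ' g (DomMulAct.mk (g : G)⁻¹ • DomMulAct.mk x⁻¹ • f -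
      DomMulAct.mk x⁻¹ • f) : ℝ) : ℂ)
    rw [map_sub, Complex.ofReal_sub, mk_inv_smul_mk_inv_smul]
  have hmψ : m' ψ = 0 := by
    rw [map_sum]
    refine Finset.sum_eq_zero fun g _ => ?_
    rw [map_sub, sub_eq_zero]
    exact hinv g _
  have hle : 0 ≤ (m' (ψ - (u : ℂ) • BoundedMeasurable.one G)).re := by
    refine BoundedMeasurable.re_nonneg_of_positive hpos _ fun x => ?_
    change 0 ≤ (ψ.1 x - (u : ℂ) * 1).re
    rw [hψ, mul_one, ← Complex.ofReal_sub, Complex.ofReal_re, sub_nonneg]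
    exact hu2 _ ⟨_, mk_inv_smul_mem_probabilityDensities hf x, rfl⟩
  have hone' : m' (BoundedMeasurable.one G) = 1 := hone
  rw [map_sub, map_smul, hmψ, hone', smul_eq_mul, mul_one, zero_sub, Complex.neg_re,
    Complex.ofReal_re] at hle
  linarith

end Reiter

/-! ### From densities in `L^1` to unit vectors in `L_2`. -/

section SquareRoot

variable {α : Type*} [MeasurableSpace α] {μ : Measure α}

theorem memLp_sqrt (f : Lp ℝ 1 μ) : MemLp (fun x => (√(f x) : ℂ)) 2 μ := by
  have hm : AEStronglyMeasurable (fun x => (√(f x) : ℂ)) μ :=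
    (Complex.continuous_ofReal.comp Real.continuous_sqrt).comp_aestronglyMeasurable
      (Lp.aestronglyMeasurable f)
  refine (memLp_two_iff_integrable_sq_norm hm).2 ((L1.integrable_coeFn f).norm.mono
    (hm.norm.pow 2) (Filter.Eventually.of_forall fun x => ?_))
  rw [Complex.norm_real, norm_pow, norm_norm, Real.norm_eq_abs, sq_abs, norm_norm,
    Real.norm_eq_abs]
  -- The real square root is `0` on negative numbers, so no sign condition on `f` is needed.
  rcases le_total 0 (f x) with h | h
  · rw [Real.sq_sqrt h, abs_of_nonneg h]
  · rw [Real.sqrt_eq_zero_of_nonpos h]; simp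

/-- The square root of a probability density, as a unit vector of `L_2`. -/
noncomputable def sqrtDensity (f : Lp ℝ 1 μ) (hf : f ∈ probabilityDensities μ) : L2Sphere μ :=
  ⟨(memLp_sqrt f).toLp _, by
    rw [mem_sphere_zero_iff_norm, ← sq_eq_sq₀ (norm_nonneg _) zero_le_one, one_pow,
      Lp.norm_sq_eq_integral, ← hf.2]
    refine integral_congr_ae ?_
    filter_upwards [(memLp_sqrt f).coeFn_toLp, hf.1] with x hx hfx
    rw [hx, Complex.norm_real, Real.norm_eq_abs, sq_abs, Real.sq_sqrt hfx]⟩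

/-- Factor `a - b = (√a - √b) (√a + √b)` and use `|√a - √b| ≤ √a + √b`. Integrated, it bounds
squared `L_2` displacement by `L^1` displacement. -/
theorem sq_sqrt_sub_sqrt_le {a b : ℝ} (ha : 0 ≤ a) (hb : 0 ≤ b) : (√a - √b) ^ 2 ≤ |a - b| := by
  have h : |a - b| = |√a - √b| * |√a + √b| := by
    rw [← abs_mul]
    congr 1
    nlinarith [Real.sq_sqrt ha, Real.sq_sqrt hb]
  rw [h, ← sq_abs, sq]
  refine mul_le_mul_of_nonneg_left ?_ (abs_nonneg _)
  have := Real.sqrt_nonneg a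
  have := Real.sqrt_nonneg b
  rw [abs_of_nonneg (by positivity : 0 ≤ √a + √b), abs_le]
  constructor <;> linarith

theorem norm_sq_leftRegular_sqrtDensity_sub_le {G : Type*} [Group G] [MeasurableSpace G]
    [MeasurableMul G] {μ : Measure G} [μ.IsMulLeftInvariant] {f : Lp ℝ 1 μ}
    (hf : f ∈ probabilityDensities μ) (g : G) :
    dist (sqrtDensity f hf) (leftRegular μ g (sqrtDensity f hf)) ^ 2 ≤
      ‖DomMulAct.mk g⁻¹ • f - f‖ := by
  rw [dist_comm, Subtype.dist_eq, dist_eq_norm, Lp.norm_sq_eq_integral, L1.norm_eq_integral_norm]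
  have hq := (measurePreserving_mul_left μ g⁻¹).quasiMeasurePreserving
  have h1 : ⇑(DomMulAct.mk g⁻¹ • f) =ᵐ[μ] fun x => f (g⁻¹ * x) :=
    DomMulAct.smul_Lp_ae_eq (DomMulAct.mk g⁻¹) f
  have h2 : ⇑(leftRegular μ g (sqrtDensity f hf)).1 =ᵐ[μ] fun x => (sqrtDensity f hf).1 (g⁻¹ * x) :=
    DomMulAct.smul_Lp_ae_eq (DomMulAct.mk g⁻¹) (sqrtDensity f hf).1
  have h3 : ⇑(sqrtDensity f hf).1 =ᵐ[μ] fun x => (√(f x) : ℂ) := (memLp_sqrt f).coeFn_toLp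
  refine integral_mono_ae ((memLp_two_iff_integrable_sq_norm (Lp.aestronglyMeasurable _)).1
    (Lp.memLp _)) (L1.integrable_coeFn _).norm ?_
  filter_upwards [Lp.coeFn_sub (leftRegular μ g (sqrtDensity f hf)).1 (sqrtDensity f hf).1,
    Lp.coeFn_sub (DomMulAct.mk g⁻¹ • f) f, h1, h2, h3, hq.ae h3, hf.1, hq.ae hf.1]
    with x e1 e2 e3 e4 e5 e6 e7 e8
  rw [e1, e2, Pi.sub_apply, Pi.sub_apply, e3, e4, e5, e6, ← Complex.ofReal_sub, Complex.norm_real,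
    Real.norm_eq_abs, Real.norm_eq_abs, sq_abs]
  exact sq_sqrt_sub_sqrt_le e8 e7

end SquareRoot

/-! ### Concentration from amenability, and the equivalence. -/

theorem IsAmenable.hasConcentrationProperty {G : Type*} [Group G] [TopologicalSpace G]
    [IsTopologicalGroup G] [LocallyCompactSpace G] [MeasurableSpace G] [BorelSpace G]
    {μ : Measure G} [μ.IsHaarMeasure] [μ.Regular] (h : IsAmenable G) :
    HasConcentrationProperty (leftRegular μ) := by
  classical
  refine hasConcentrationProperty_of_almost_fixed (F' := fun g => leftRegular μ g⁻¹)
    (fun g f => ?_) fun s ε hε => ?_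
  · rw [← leftRegular_mul, mul_inv_cancel, leftRegular_one, id]
  -- The maps to be almost fixed are the inverse translations, hence the image under inversion; `ε ^
  -- 2` compensates for the square root.
  · obtain ⟨f, hf, hfs⟩ :=
      h.exists_almost_invariant_density μ (s.image fun g => g⁻¹) (pow_pos hε 2)
    refine ⟨sqrtDensity f hf, fun g hg => lt_of_pow_lt_pow_left₀ 2 hε.le ?_⟩
    exact (norm_sq_leftRegular_sqrtDensity_sub_le hf g⁻¹).trans_lt
      (hfs _ (Finset.mem_image_of_mem _ hg))

theorem proposition3p1 {G : Type*} [Group G] [TopologicalSpace G] [IsTopologicalGroup G]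
    [LocallyCompactSpace G] [MeasurableSpace G] [BorelSpace G]
    (μ : Measure G) [μ.IsHaarMeasure] [μ.Regular] :
    List.TFAE
      [IsAmenable G,
       HasInvariantUCBMean (leftRegular μ) (uniformContinuous_leftRegular μ),
       HasConcentrationProperty (leftRegular μ)] := by
  have hne : Nonempty (L2Sphere μ) :=
    let ⟨f, hf⟩ := exists_mem_probabilityDensities μ
    ⟨sqrtDensity f hf⟩
  tfae_have 1 → 2 := fun h => h.hasInvariantUCBMean μ
  tfae_have 2 → 1 := fun h => h.isAmenable
  tfae_have 1 → 3 := fun h => h.hasConcentrationProperty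
  tfae_have 3 → 2 := fun h => h.hasInvariantUCBMean _ (leftRegular_one μ)
  tfae_finish
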